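/- Let $G=(V,E)$ be a finite simple graph with $V \neq \emptyset$ and let $\lambda=(\lambda_i)_{i\in V}$ be a vector of positive arrival rates. Items arrive one by one; the classes $I_0, I_1, \dots$ of the successive items are i.i.d., equal to $i$ with probability $\lambda_i/\sum_{j\in V}\lambda_j$. A *policy* $\Phi$ adapted to $G$ consists of a countably infinite set $\mathcal S$ of states, a map $|\cdot|:\mathcal S\to\mathbb N^V$ giving the number of unmatched items of each class, such that there is exactly one state $\varnothing$ with $|\varnothing|=0$, and, for each $s\in\mathcal S$ and $i\in V$, a probability distribution $(j,s')\mapsto\Phi(s,i,j,s')$ on $(V\cup\{\bot\})\times\mathcal S$ such that $\Phi(s,i,j,s')>0$ only if either $j=\bot$ and $|s'|=|s|+\mathbf 1_i$, or $\{i,j\}\in E$, $|s|_j\ge 1$ and $|s'|=|s|-\mathbf 1_j$. Here $\Phi(s,i,j,s')$ is the conditional probability that, given that an incoming class-$i$ item finds the system in state $s$, it is matched with an unmatched class-$j$ item (left unmatched if $j=\bot$) and the new state is $s'$; write $J_t$ for the decision made at the arrival of item $I_t$. The Markov chain $(S_t)_{t\in\mathbb N}$ of system states, started from $S_0=\varnothing$,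 is required to be irreducible on $\mathcal S$. The policy is *stable* if this chain is positive recurrent, and *greedy* if $\sum_{s'}\Phi(s,i,\bot,s')=0$ whenever $|s|_j\ge1$ for some neighbor $j$ of $i$. The *matching-rate vector* $\mu(\Phi)=(\mu_e)_{e\in E}$ of a stable policy is given by the almost sure limits $$\mu_e=\lim_{t\to\infty}\Bigl(\sum_{i\in V}\lambda_i\Bigr)\,\frac1t\,\#\bigl\{u<t:\ \{I_u,J_u\}=e\bigr\},\qquad e\in E.$$ Let $\Pi_{\mathrm{Pol}}\subseteq\mathbb R^E$ be the set of the vectors $\mu(\Phi)$ over all stable policies $\Phi$ adapted to $G$, and let $\Pi_{\mathrm{Gre}}\subseteq\mathbb R^E$ be the set of the vectors $\mu(\Phi)$ over all stable greedy policies $\Phi$ adapted to $G$. Then $\Pi_{\mathrm{Gre}}$ and $\Pi_{\mathrm{Pol}}$ are convex. -/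

import Mathlib

open MeasureTheory ProbabilityTheory Filter Topology
open scoped ENNReal

noncomputable section

/-- A matching problem `(G, λ)`: a simple compatibility graph on the item classes `V`, together
with a positive arrival rate for every class. -/
structure MatchingProblem (V : Type*) where
  graph : SimpleGraph V
  rate : V → ℝ
  rate_pos : ∀ i, 0 < rate i

/-- The effect of the arrival of one item: its class, the matching decision (`none` means that the
item is left unmatched, `some j` that it is matched with an unmatched item of class `j`), and the
new system state. -/
structure MatchingStep (V S : Type*) where
  arrival : V
  decision : Option V
  next : S

/-- Steps are only used for countable `V` and `S`; they carry the discrete σ-algebra. -/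
instance instMeasurableSpaceMatchingStep {V S : Type*} : MeasurableSpace (MatchingStep V S) := ⊤

/-- A (random, state-dependent) matching policy with state space `(S, |·|)`, where `size s i` is the
number of unmatched items of class `i` in state `s`. `kernel s i (j, s')` is the conditional
probability that the decision is `j` and the new state is `s'`, given that an incoming class-`i`
item finds the system in state `s`. There is exactly one state without unmatched items. -/
structure MatchingPolicy {V : Type*} [DecidableEq V] (G : SimpleGraph V) (S : Type*) where
  size : S → V → ℕ
  empty : S
  size_eq_zero_iff : ∀ s, size s = 0 ↔ s = empty
  kernel : S → V → PMF (Option V × S)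
  /-- An item that is not matched joins the queue of its class. -/
  consistent_none : ∀ s i s', kernel s i (none, s') ≠ 0 → size s' = size s + Pi.single i 1
  /-- The policy is adapted to `G`: items are only matched along the edges of `G`. -/
  adapted : ∀ s i j s', kernel s i (some j, s') ≠ 0 → G.Adj i j ∧ 1 ≤ size s j
  /-- A matched item leaves the queue of its class. -/
  consistent_some : ∀ s i j s', kernel s i (some j, s') ≠ 0 → size s' + Pi.single j 1 = size s

namespace MatchingProblem

variable {V : Type*} [Fintype V] [Nonempty V]

/-- The distribution of the class of an incoming item: class `i` has probability
`λ i / ∑ j, λ j`. -/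
def arrivalPMF (P : MatchingProblem V) : PMF V :=
  PMF.normalize (fun i => ENNReal.ofReal (P.rate i))
    (by
      rw [ne_eq, ENNReal.tsum_eq_zero]
      intro h
      obtain ⟨i⟩ := ‹Nonempty V›
      exact absurd (ENNReal.ofReal_eq_zero.1 (h i)) (not_le.2 (P.rate_pos i)))
    (by
      rw [tsum_fintype]
      exact ENNReal.sum_ne_top.2 fun i _ => ENNReal.ofReal_ne_top)

end MatchingProblem

namespace MatchingPolicy

variable {V : Type*} [DecidableEq V] {S : Type*}

/-- A policy is greedy if an incoming item is matched whenever an unmatched compatible item is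
present. -/
def IsGreedy {G : SimpleGraph V} (Φ : MatchingPolicy G S) : Prop :=
  ∀ s i, (∃ j, G.Adj i j ∧ 1 ≤ Φ.size s j) → ∑' s', Φ.kernel s i (none, s') = 0

variable [Fintype V] [Nonempty V] {P : MatchingProblem V} (Φ : MatchingPolicy P.graph S)

/-- The distribution of the step made from state `s`: the class `i` of the incoming item follows
the arrival distribution, and the decision and the new state follow `Φ s i`. -/
def stepPMF (s : S) : PMF (MatchingStep V S) :=
  P.arrivalPMF.bind fun i => (Φ.kernel s i).map fun p => ⟨i, p.1, p.2⟩

/-- The one-step transition probabilities of the Markov chain of system states. -/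
def transitionPMF (s : S) : PMF S :=
  (Φ.stepPMF s).map MatchingStep.next

/-- The Markov chain of system states is irreducible: any state can be reached from any state by
finitely many transitions of positive probability. -/
def IsIrreducible : Prop :=
  ∀ s s', Relation.ReflTransGen (fun a b => Φ.transitionPMF a b ≠ 0) s s'

/-- The Markov kernel of the sequence of steps: given the first `n + 1` steps, the next one is made
from the state reached by the last of them. -/
def stepKernel (n : ℕ) : Kernel (Finset.Iic n → MatchingStep V S) (MatchingStep V S) where
  toFun h := (Φ.stepPMF (h ⟨n, Finset.mem_Iic.2 le_rfl⟩).next).toMeasure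
  measurable' := by
    have h1 : Measurable fun y : MatchingStep V S => (Φ.stepPMF y.next).toMeasure :=
      measurable_from_top
    exact h1.comp (measurable_pi_apply _)

instance instIsMarkovKernelStepKernel (n : ℕ) : IsMarkovKernel (Φ.stepKernel n) where
  isProbabilityMeasure _ := PMF.toMeasure.isProbabilityMeasure _

/-- The law of the sequence of steps `((I_t, J_t, S_{t+1}), t ∈ ℕ)` of the system when the initial
state is `S_0 = s`. -/
def law (s : S) : Measure (ℕ → MatchingStep V S) :=
  Kernel.trajMeasure (X := fun _ => MatchingStep V S) (Φ.stepPMF s).toMeasure Φ.stepKernel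

end MatchingPolicy

namespace MatchingStep

variable {V S : Type*}

/-- The state `S_t` along a sequence of steps that starts in state `s`. -/
def state (s : S) (ω : ℕ → MatchingStep V S) : ℕ → S
  | 0 => s
  | t + 1 => (ω t).next

/-- The first time `t ≥ 1` at which the state is again the initial state `s` (`∞` if there is no
such time). -/
def returnTime (s : S) (ω : ℕ → MatchingStep V S) : ℝ≥0∞ :=
  ⨅ (t : ℕ) (_ : 1 ≤ t ∧ state s ω t = s), (t : ℝ≥0∞)

open Classical in
/-- The number of matches along the edge `e` over the first `t` arrivals. -/
def matchCount (e : Sym2 V) (ω : ℕ → MatchingStep V S) (t : ℕ) : ℕ :=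
  ((Finset.range t).filter fun u => ∃ j, (ω u).decision = some j ∧ s((ω u).arrival, j) = e).card

end MatchingStep

namespace MatchingPolicy

variable {V : Type*} [DecidableEq V] [Fintype V] [Nonempty V] {S : Type*}
  {P : MatchingProblem V} (Φ : MatchingPolicy P.graph S)

/-- The policy is stable: the Markov chain of system states is positive recurrent, that is, the
mean return time to every state is finite. -/
def IsStable : Prop :=
  ∀ s, ∫⁻ ω, MatchingStep.returnTime s ω ∂(Φ.law s) < ∞

/-- `μ` is the vector of matching rates, for the system that is initially empty: for every edge
`e`, almost surely, the number of matches along `e` per arrival, multiplied by the total arrival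
rate, tends to `μ e`. -/
def HasMatchingRates (μ : P.graph.edgeSet → ℝ) : Prop :=
  ∀ e : P.graph.edgeSet, ∀ᵐ ω ∂(Φ.law Φ.empty),
    Tendsto (fun t : ℕ => (∑ i, P.rate i) * ((MatchingStep.matchCount (e : Sym2 V) ω t : ℝ) / t))
      atTop (𝓝 (μ e))

end MatchingPolicy

namespace MatchingProblem

variable {V : Type*} [DecidableEq V] [Fintype V] [Nonempty V]

/-- The set of the matching-rate vectors achieved by stable policies: policies adapted to the
compatibility graph, with a countably infinite state space on which the Markov chain of system
states is irreducible and positive recurrent. -/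
def policyRates (P : MatchingProblem V) : Set (P.graph.edgeSet → ℝ) :=
  {μ | ∃ (S : Type) (_ : Countable S) (_ : Infinite S) (Φ : MatchingPolicy P.graph S),
    Φ.IsIrreducible ∧ Φ.IsStable ∧ Φ.HasMatchingRates μ}

/-- The set of the matching-rate vectors achieved by stable greedy policies. -/
def greedyRates (P : MatchingProblem V) : Set (P.graph.edgeSet → ℝ) :=
  {μ | ∃ (S : Type) (_ : Countable S) (_ : Infinite S) (Φ : MatchingPolicy P.graph S),
    Φ.IsGreedy ∧ Φ.IsIrreducible ∧ Φ.IsStable ∧ Φ.HasMatchingRates μ}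

end MatchingProblem

end

/-!
A stable policy is a regenerative process: the cycles between successive visits of the empty state
are independent and identically distributed, and their mean length is finite. Hence its matching
rate along an edge `e` is, up to the total arrival rate, the mean number `M e` of matches along `e`
in a cycle divided by the mean length `L` of a cycle (`MatchingPolicy.hasMatchingRates_iff`).

Given stable policies `Φ b` with cycle means `M b e` and `L b`, consider the policy
`MatchingPolicy.mix`, which draws an index `b` with probability `q b` whenever the system is empty
and follows `Φ b` until the system is empty again. Its state space is the disjoint union of the
given ones with the empty states identified, so that it is countable, has exactly one empty state,
and is irreducible as soon as all `q b` are positive; every decision is one of some `Φ b`, so that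
adaptedness and greediness are inherited. Its cycle means are the averages `∑ b, q b * M b e` and
`∑ b, q b * L b` (`MatchingPolicy.meanCost_mix_none`). With `q b` proportional to `β b / L b`, the
quotient of the two is `∑ b, β b * (M b e / L b)`, the required convex combination
(`MatchingPolicy.exists_mix_hasMatchingRates`).

Two facts on Markov chains are needed. An irreducible chain with finite mean return time to one
state is positive recurrent (`MatchingPolicy.IsIrreducible.isStable`): an excursion from that state
visits any other given state with positive probability, so that the number of excursions before the
visit is dominated by a geometric one. The cycle formula `MatchingPolicy.ae_tendsto_reward_div`
follows from the strong Markov property at the first return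
(`MatchingPolicy.lintegral_cycleReward_mul`), which makes the shift by one cycle measure preserving
and the first cycle independent of the later ones, and from the strong law of large numbers. Both
rest on the first-step formula `MatchingPolicy.lintegral_law`, obtained by comparing the
probabilities of cylinders.
-/

/-! ### The law of the sequence of steps -/

instance instDiscreteMeasurableSpaceMatchingStep {V S : Type*} :
    DiscreteMeasurableSpace (MatchingStep V S) := ⟨fun _ => trivial⟩

instance instCountableMatchingStep {V S : Type*} [Countable V] [Countable S] :
    Countable (MatchingStep V S) :=
  Function.Injective.countable (f := fun x : MatchingStep V S => (x.arrival, x.decision, x.next))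
    fun x y h => by cases x; cases y; simp_all

namespace MatchingStep

variable {V S : Type*}

/-- The sequence of steps `x, ω 0, ω 1, …`. -/
def cons (x : MatchingStep V S) (ω : ℕ → MatchingStep V S) : ℕ → MatchingStep V S
  | 0 => x
  | n + 1 => ω n

@[simp] lemma cons_zero (x : MatchingStep V S) (ω : ℕ → MatchingStep V S) : cons x ω 0 = x := rfl

lemma measurable_cons (x : MatchingStep V S) : Measurable (cons x) :=
  measurable_pi_iff.2 fun n => by
    cases n with
    | zero => exact measurable_const
    | succ n => exact measurable_pi_apply n

lemma state_cons_succ (s : S) (x : MatchingStep V S) (ω : ℕ → MatchingStep V S) (n : ℕ) :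
    state s (cons x ω) (n + 1) = state x.next ω n := by
  cases n <;> rfl

/-- The sequence of steps seen after the first `n` of them. -/
def shift (n : ℕ) (ω : ℕ → MatchingStep V S) : ℕ → MatchingStep V S := fun i => ω (i + n)

lemma measurable_shift (n : ℕ) : Measurable (shift (V := V) (S := S) n) :=
  measurable_pi_iff.2 fun i => measurable_pi_apply (i + n)

/-- A probability law on sequences of steps is determined by its values on the cylinders that fix
the first `n` steps. -/
lemma ext_of_cylinder [Countable V] [Countable S] {μ ν : Measure (ℕ → MatchingStep V S)}
    [IsProbabilityMeasure μ] [IsProbabilityMeasure ν]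
    (h : ∀ (n : ℕ) (x : ℕ → MatchingStep V S),
      μ {ω | ∀ i < n, ω i = x i} = ν {ω | ∀ i < n, ω i = x i}) : μ = ν := by
  have hIic (n : ℕ) : μ.map (Preorder.frestrictLe n) = ν.map (Preorder.frestrictLe n) := by
    obtain ⟨ω₀⟩ : Nonempty (ℕ → MatchingStep V S) := μ.nonempty_of_neZero
    refine Measure.ext_of_singleton fun y => ?_
    rw [Measure.map_apply (Preorder.measurable_frestrictLe n) (measurableSet_singleton y),
      Measure.map_apply (Preorder.measurable_frestrictLe n) (measurableSet_singleton y)]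
    have hset : Preorder.frestrictLe (π := fun _ => MatchingStep V S) n ⁻¹' {y}
        = {ω | ∀ i < n + 1, ω i = if hi : i ≤ n then y ⟨i, Finset.mem_Iic.2 hi⟩ else ω₀ i} := by
      ext ω
      simp only [Set.mem_preimage, Set.mem_singleton_iff, Set.mem_ofPred_eq, funext_iff,
        Subtype.forall, Finset.mem_Iic, Preorder.frestrictLe_apply, Nat.lt_succ_iff]
      refine forall₂_congr fun i hi => ?_
      rw [dif_pos hi]
    rw [hset, h]
  have hproj (I : Finset ℕ) : ν.map I.restrict = μ.map I.restrict := by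
    have hI : I ⊆ Finset.Iic (I.sup id) := fun i hi => Finset.mem_Iic.2 (Finset.le_sup (f := id) hi)
    have hcomp : (I.restrict : (ℕ → MatchingStep V S) → _)
        = Finset.restrict₂ hI ∘ Preorder.frestrictLe (I.sup id) := rfl
    rw [hcomp, ← Measure.map_map (Finset.measurable_restrict₂ hI)
      (Preorder.measurable_frestrictLe _), ← Measure.map_map (Finset.measurable_restrict₂ hI)
      (Preorder.measurable_frestrictLe _), hIic]
  exact IsProjectiveLimit.unique (P := fun I : Finset ℕ => μ.map I.restrict)
    (fun _ => rfl) hproj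

end MatchingStep

namespace MatchingPolicy

open MatchingStep

variable {V : Type*} [DecidableEq V] [Fintype V] [Nonempty V] {S : Type*}
  {P : MatchingProblem V} (Φ : MatchingPolicy P.graph S)

instance instIsProbabilityMeasureStep (s : S) : IsProbabilityMeasure (Φ.stepPMF s).toMeasure :=
  PMF.toMeasure.isProbabilityMeasure _

instance instIsProbabilityMeasureLaw (s : S) : IsProbabilityMeasure (Φ.law s) := by
  unfold law; infer_instance

lemma map_frestrictLe_zero_law (s : S) :
    (Φ.law s).map (Preorder.frestrictLe 0)
      = (Φ.stepPMF s).toMeasure.map (MeasurableEquiv.piUnique _).symm := by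
  rw [law, Kernel.trajMeasure, Measure.map_comp _ _ (by fun_prop), Kernel.traj_map_frestrictLe,
    Kernel.partialTraj_self, Measure.id_comp]

/-- The probability that the first `n` steps are those of `x` is the product of their one-step
probabilities. -/
lemma law_cylinder [Countable S] (s : S) (n : ℕ) (x : ℕ → MatchingStep V S) :
    Φ.law s {ω | ∀ i < n, ω i = x i} = ∏ i ∈ Finset.range n, Φ.stepPMF (state s x i) (x i) := by
  induction n with
  | zero => simp
  | succ n ih =>
    rw [Finset.prod_range_succ]
    cases n with
    | zero =>
      have hset : {ω : ℕ → MatchingStep V S | ∀ i < 0 + 1, ω i = x i}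
          = Preorder.frestrictLe (π := fun _ => MatchingStep V S) 0 ⁻¹'
            {y | y ⟨0, by simp⟩ = x 0} := by
        ext ω; simp
      have hms : MeasurableSet {y : Finset.Iic 0 → MatchingStep V S | y ⟨0, by simp⟩ = x 0} :=
        .of_discrete
      rw [hset, ← Measure.map_apply (Preorder.measurable_frestrictLe 0) hms,
        map_frestrictLe_zero_law, Measure.map_apply (MeasurableEquiv.measurable _) hms]
      simp only [Finset.range_zero, Finset.prod_empty, one_mul, state]
      rw [← PMF.toMeasure_apply_singleton _ (x 0) (measurableSet_singleton _)]
      rfl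
    | succ n =>
      have key := congrArg
        (fun m => m ({Preorder.frestrictLe (π := fun _ => MatchingStep V S) n x} ×ˢ {x (n + 1)}))
        (Kernel.map_frestrictLe_trajMeasure_compProd_eq_map_trajMeasure
          (X := fun _ => MatchingStep V S) (μ₀ := (Φ.stepPMF s).toMeasure)
          (κ := Φ.stepKernel) (a := n))
      have hm : Measurable fun ω : ℕ → MatchingStep V S => (Preorder.frestrictLe n ω, ω (n + 1)) :=
        (Preorder.measurable_frestrictLe n).prodMk (measurable_pi_apply _)
      rw [Measure.compProd_apply_prod (measurableSet_singleton _) (measurableSet_singleton _),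
        lintegral_singleton, Measure.map_apply (Preorder.measurable_frestrictLe n)
          (measurableSet_singleton _), Measure.map_apply hm
          ((measurableSet_singleton _).prod (measurableSet_singleton _))] at key
      have h1 : Preorder.frestrictLe (π := fun _ => MatchingStep V S) n ⁻¹'
          {Preorder.frestrictLe n x} = {ω | ∀ i < n + 1, ω i = x i} := by
        ext ω
        simp [funext_iff]
      have h2 : (fun ω : ℕ → MatchingStep V S => (Preorder.frestrictLe n ω, ω (n + 1))) ⁻¹'
          ({Preorder.frestrictLe n x} ×ˢ {x (n + 1)}) = {ω | ∀ i < n + 1 + 1, ω i = x i} := by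
        ext ω
        simp only [Set.mem_preimage, Set.mem_prod, Set.mem_singleton_iff, funext_iff,
          Subtype.forall, Finset.mem_Iic, Preorder.frestrictLe_apply, Set.mem_ofPred_eq]
        refine ⟨fun h i hi => ?_, fun h => ⟨fun i hi => h i (by omega), h _ (by omega)⟩⟩
        rcases Nat.lt_succ_iff_lt_or_eq.1 hi with hi | rfl
        · exact h.1 i (by omega)
        · exact h.2
      rw [h1, h2] at key
      change _ = Φ.law s _ at key
      rw [← key, mul_comm]
      congr 1
      exact PMF.toMeasure_apply_singleton _ _ (measurableSet_singleton _)

/-- The Markov property at time one: after a first step `x` made from `s`, the system evolves as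
if it were started in the state reached by `x`. -/
lemma law_eq_bind [Countable S] (s : S) :
    Φ.law s = (Φ.stepPMF s).toMeasure.bind fun x => (Φ.law x.next).map (cons x) := by
  have hb : IsProbabilityMeasure
      ((Φ.stepPMF s).toMeasure.bind fun x => (Φ.law x.next).map (cons x)) := by
    constructor
    rw [Measure.bind_apply .univ Measurable.of_discrete.aemeasurable]
    simp [Measure.map_apply (measurable_cons _)]
  refine ext_of_cylinder fun n x => ?_
  have hms (n : ℕ) (x : ℕ → MatchingStep V S) :
      MeasurableSet {ω : ℕ → MatchingStep V S | ∀ i < n, ω i = x i} := by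
    have : {ω : ℕ → MatchingStep V S | ∀ i < n, ω i = x i}
        = ⋂ i, ⋂ (_ : i < n), {ω | ω i = x i} := by
      ext; simp
    rw [this]
    exact .iInter fun i => .iInter fun _ =>
      measurableSet_eq_fun (measurable_pi_apply i) measurable_const
  cases n with
  | zero => simp
  | succ n =>
    rw [Measure.bind_apply (hms _ _) Measurable.of_discrete.aemeasurable,
      law_cylinder, Finset.prod_range_succ', mul_comm]
    have hcons (y : MatchingStep V S) : (Φ.law y.next).map (cons y) {ω | ∀ i < n + 1, ω i = x i}
        = ({x 0} : Set (MatchingStep V S)).indicator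
          (fun y => Φ.law y.next {ω | ∀ i < n, ω i = x (i + 1)}) y := by
      have hpre (ω : ℕ → MatchingStep V S) : ω ∈ cons y ⁻¹' {ω | ∀ i < n + 1, ω i = x i}
          ↔ y = x 0 ∧ ∀ i < n, ω i = x (i + 1) := by
        rw [Set.mem_preimage, Set.mem_ofPred_eq, Nat.forall_lt_succ_left]
        rfl
      rw [Measure.map_apply (measurable_cons y) (hms _ _)]
      by_cases hy : y = x 0
      · rw [Set.indicator_of_mem (by simpa using hy)]
        congr 1
        ext ω
        rw [hpre]
        simp [hy]
      · rw [Set.indicator_of_notMem (by simpa using hy)]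
        convert measure_empty (μ := Φ.law y.next)
        ext ω
        rw [hpre]
        simp [hy]
    simp_rw [hcons]
    rw [lintegral_indicator (measurableSet_singleton _), lintegral_singleton, mul_comm,
      PMF.toMeasure_apply_singleton _ _ (measurableSet_singleton _), law_cylinder]
    congr 1
    refine Finset.prod_congr rfl fun i _ => ?_
    cases i <;> rfl

/-- The first-step formula, the integral form of `law_eq_bind`. -/
lemma lintegral_law [Countable S] (s : S) {F : (ℕ → MatchingStep V S) → ℝ≥0∞}
    (hF : Measurable F) :
    ∫⁻ ω, F ω ∂Φ.law s
      = ∫⁻ x, ∫⁻ ω, F (cons x ω) ∂Φ.law x.next ∂(Φ.stepPMF s).toMeasure := by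
  rw [law_eq_bind, Measure.lintegral_bind Measurable.of_discrete.aemeasurable hF.aemeasurable]
  exact lintegral_congr fun x => lintegral_map hF (measurable_cons x)

end MatchingPolicy

/-! ### Mean costs up to a hitting time -/

namespace MatchingStep

variable {V S : Type*}

open Classical in
/-- The total cost of the first `n` steps, where the step `x` costs `c x` and the costs are no
longer counted after the first step that ends in `A`. -/
noncomputable def stopSum (A : Set S) (c : MatchingStep V S → ℝ≥0∞) :
    ℕ → (ℕ → MatchingStep V S) → ℝ≥0∞
  | 0, _ => 0
  | n + 1, ω => c (ω 0) + if (ω 0).next ∈ A then 0 else stopSum A c n (shift 1 ω)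

lemma measurable_stopSum (A : Set S) (c : MatchingStep V S → ℝ≥0∞) (n : ℕ) :
    Measurable (stopSum A c n) := by
  induction n with
  | zero => exact measurable_const
  | succ n ih =>
    have h0 : Measurable fun ω : ℕ → MatchingStep V S => ω 0 := measurable_pi_apply 0
    refine ((Measurable.of_discrete (f := c)).comp h0).add
      (Measurable.ite ?_ measurable_const (ih.comp (measurable_shift 1)))
    exact h0 (MeasurableSet.of_discrete (s := {x : MatchingStep V S | x.next ∈ A}))

lemma monotone_stopSum (A : Set S) (c : MatchingStep V S → ℝ≥0∞) (ω : ℕ → MatchingStep V S) :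
    Monotone fun n => stopSum A c n ω := by
  refine monotone_nat_of_le_succ fun n => ?_
  induction n generalizing ω with
  | zero => exact zero_le
  | succ n ih =>
    by_cases h : (ω 0).next ∈ A
    · simp [stopSum, h]
    · rw [stopSum, stopSum, if_neg h, if_neg h]
      gcongr
      exact ih (shift 1 ω)

/-- The first step that ends in `r` is the step number `n` (counted from `0`). -/
def IsFirstVisit (r : S) (n : ℕ) (ω : ℕ → MatchingStep V S) : Prop :=
  (∀ i < n, (ω i).next ≠ r) ∧ (ω n).next = r

lemma exists_isFirstVisit {r : S} {ω : ℕ → MatchingStep V S} {n : ℕ} (h : (ω n).next = r) :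
    ∃ m, IsFirstVisit r m ω := by
  classical
  exact ⟨Nat.find ⟨n, h⟩, fun i hi => Nat.find_min ⟨n, h⟩ hi,
    Nat.find_spec (p := fun m => (ω m).next = r) ⟨n, h⟩⟩

lemma stopSum_eq_sum {r : S} {c : MatchingStep V S → ℝ≥0∞} {n : ℕ} {ω : ℕ → MatchingStep V S}
    (h : ∀ i < n, (ω i).next ≠ r) : stopSum {r} c n ω = ∑ i ∈ Finset.range n, c (ω i) := by
  induction n generalizing ω with
  | zero => simp [stopSum]
  | succ n ih =>
    rw [stopSum, if_neg (by simpa using h 0 (by omega)),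
      ih (ω := shift 1 ω) fun i hi => h (i + 1) (by omega), Finset.sum_range_succ', add_comm]
    rfl

lemma iSup_stopSum_eq_sum {r : S} {c : MatchingStep V S → ℝ≥0∞} {m : ℕ}
    {ω : ℕ → MatchingStep V S} (h : IsFirstVisit r m ω) :
    ⨆ n, stopSum {r} c n ω = ∑ i ∈ Finset.range (m + 1), c (ω i) := by
  have key : (∀ n, stopSum {r} c n ω ≤ ∑ i ∈ Finset.range (m + 1), c (ω i)) ∧
      stopSum {r} c (m + 1) ω = ∑ i ∈ Finset.range (m + 1), c (ω i) := by
    induction m generalizing ω with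
    | zero =>
      have h0 : (ω 0).next = r := h.2
      refine ⟨fun n => ?_, by simp [stopSum, h0]⟩
      cases n <;> simp [stopSum, h0]
    | succ m ih =>
      have h0 : (ω 0).next ∉ ({r} : Set S) := by simpa using h.1 0 (by omega)
      have hs : IsFirstVisit r m (shift 1 ω) :=
        ⟨fun i hi => h.1 (i + 1) (by omega), h.2⟩
      rw [Finset.sum_range_succ', add_comm (∑ i ∈ _, _), stopSum, if_neg h0, (ih hs).2]
      refine ⟨fun n => ?_, rfl⟩
      cases n with
      | zero => exact zero_le
      | succ n =>
        rw [stopSum, if_neg h0]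
        gcongr
        exact (ih hs).1 n
  exact le_antisymm (iSup_le key.1) (key.2 ▸ le_iSup (fun n => stopSum {r} c n ω) (m + 1))

lemma returnTime_eq_iSup_stopSum (s : S) (ω : ℕ → MatchingStep V S) :
    returnTime s ω = ⨆ n, stopSum {s} (fun _ => 1) n ω := by
  by_cases h : ∃ n, (ω n).next = s
  · obtain ⟨n, hn⟩ := h
    obtain ⟨m, hm⟩ := exists_isFirstVisit hn
    rw [iSup_stopSum_eq_sum hm, returnTime]
    simp only [Finset.sum_const, Finset.card_range, nsmul_eq_mul, mul_one]
    refine le_antisymm (iInf₂_le (m + 1) ⟨by omega, hm.2⟩) (le_iInf₂ fun t ht => ?_)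
    obtain ⟨ht1, hts⟩ := ht
    obtain ⟨t, rfl⟩ := Nat.exists_eq_add_of_le' ht1
    have : m ≤ t := not_lt.1 fun hlt => hm.1 t hlt hts
    exact_mod_cast Nat.succ_le_succ this
  · push Not at h
    rw [returnTime, iInf_eq_top.2]
    · simp_rw [stopSum_eq_sum fun i _ => h i]
      simp [ENNReal.iSup_natCast]
    · intro t
      refine iInf_eq_top.2 fun ht => ?_
      obtain ⟨ht1, hts⟩ := ht
      obtain ⟨t, rfl⟩ := Nat.exists_eq_add_of_le' ht1
      exact absurd hts (h t)

end MatchingStep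

lemma PMF.ae_toMeasure_iff {α : Type*} [MeasurableSpace α] [DiscreteMeasurableSpace α]
    (p : PMF α) {q : α → Prop} : (∀ᵐ x ∂p.toMeasure, q x) ↔ ∀ x, p x ≠ 0 → q x := by
  rw [ae_iff, PMF.toMeasure_apply_eq_zero_iff _ .of_discrete, Set.disjoint_left]
  simp only [PMF.mem_support_iff, Set.mem_ofPred_eq, not_not]

namespace MatchingPolicy

open MatchingStep

variable {V : Type*} [DecidableEq V] [Fintype V] [Nonempty V] {S : Type*}
  {P : MatchingProblem V} (Φ : MatchingPolicy P.graph S)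

open Classical in
/-- The expected total cost of the first `n` steps from `s`, counted up to the first step that ends
in `A`. -/
noncomputable def expectedCost (A : Set S) (c : MatchingStep V S → ℝ≥0∞) : ℕ → S → ℝ≥0∞
  | 0, _ => 0
  | n + 1, s => ∫⁻ x, c x + (if x.next ∈ A then 0 else expectedCost A c n x.next)
      ∂(Φ.stepPMF s).toMeasure

/-- The expected total cost of the steps made from `s`, counted up to the first step that ends
in `A`. -/
noncomputable def meanCost (A : Set S) (c : MatchingStep V S → ℝ≥0∞) (s : S) : ℝ≥0∞ :=
  ⨆ n, Φ.expectedCost A c n s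

lemma lintegral_stopSum [Countable S] (A : Set S) (c : MatchingStep V S → ℝ≥0∞) (n : ℕ) (s : S) :
    ∫⁻ ω, stopSum A c n ω ∂Φ.law s = Φ.expectedCost A c n s := by
  induction n generalizing s with
  | zero => simp [stopSum, expectedCost]
  | succ n ih =>
    rw [lintegral_law _ _ (measurable_stopSum _ _ _), expectedCost]
    refine lintegral_congr fun x => ?_
    have hx (ω : ℕ → MatchingStep V S) : shift 1 (cons x ω) = ω := rfl
    simp only [stopSum, cons_zero, hx]
    rw [lintegral_add_left measurable_const]
    by_cases h : x.next ∈ A <;> simp [h, ih]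

lemma lintegral_iSup_stopSum [Countable S] (A : Set S) (c : MatchingStep V S → ℝ≥0∞) (s : S) :
    ∫⁻ ω, ⨆ n, stopSum A c n ω ∂Φ.law s = Φ.meanCost A c s := by
  rw [lintegral_iSup (measurable_stopSum A c) fun m n h ω => monotone_stopSum A c ω h, meanCost]
  simp_rw [lintegral_stopSum]

lemma lintegral_returnTime [Countable S] (s : S) :
    ∫⁻ ω, returnTime s ω ∂Φ.law s = Φ.meanCost {s} (fun _ => 1) s := by
  simp_rw [returnTime_eq_iSup_stopSum, lintegral_iSup_stopSum]

lemma monotone_expectedCost (A : Set S) (c : MatchingStep V S → ℝ≥0∞) :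
    Monotone (Φ.expectedCost A c) := by
  refine monotone_nat_of_le_succ fun n => ?_
  induction n with
  | zero => exact fun _ => zero_le
  | succ n ih =>
    intro s
    refine lintegral_mono fun x => ?_
    dsimp only
    gcongr
    split_ifs
    · exact le_rfl
    · exact ih _

open Classical in
/-- Mean costs solve the first-step equation. -/
lemma meanCost_eq (A : Set S) (c : MatchingStep V S → ℝ≥0∞) (s : S) :
    Φ.meanCost A c s = ∫⁻ x, c x + (if x.next ∈ A then 0 else Φ.meanCost A c x.next)
      ∂(Φ.stepPMF s).toMeasure := by
  have hmono (x : MatchingStep V S) :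
      Monotone fun n => if x.next ∈ A then 0 else Φ.expectedCost A c n x.next := by
    intro m n h
    dsimp only
    split_ifs
    · exact le_rfl
    · exact Φ.monotone_expectedCost A c h _
  have hsup (x : MatchingStep V S) :
      (c x + if x.next ∈ A then 0 else Φ.meanCost A c x.next)
        = ⨆ n, (c x + if x.next ∈ A then 0 else Φ.expectedCost A c n x.next) := by
    rw [← ENNReal.add_iSup]
    split_ifs <;> simp [meanCost]
  simp_rw [hsup]
  rw [lintegral_iSup (fun _ => .of_discrete) fun m n h x => by
    simpa using add_le_add_right (hmono x h) (c x)]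
  rw [meanCost, ← Monotone.iSup_nat_add (fun m n h => Φ.monotone_expectedCost A c h s) 1]
  simp only [expectedCost]

/-! ### Positive recurrence -/

lemma transitionPMF_ne_zero_iff {a b : S} :
    Φ.transitionPMF a b ≠ 0 ↔ ∃ x, Φ.stepPMF a x ≠ 0 ∧ x.next = b := by
  rw [← PMF.mem_support_iff, transitionPMF, PMF.mem_support_map_iff]
  simp only [PMF.mem_support_iff]

/-- In an irreducible system, the mean time to reach the state `r` is finite from every state if
it is finite from `r`: the states visited between two visits of `r` are all states. -/
lemma IsIrreducible.meanCost_lt_top {Φ : MatchingPolicy P.graph S} (hΦ : Φ.IsIrreducible) {r : S}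
    (hr : Φ.meanCost {r} (fun _ => 1) r < ∞) (s : S) : Φ.meanCost {r} (fun _ => 1) s < ∞ := by
  induction hΦ r s with
  | refl => exact hr
  | @tail a b _ hab ih =>
    by_cases hb : b = r
    · exact hb ▸ hr
    obtain ⟨x, hx, rfl⟩ := Φ.transitionPMF_ne_zero_iff.1 hab
    rw [meanCost_eq] at ih
    have := (PMF.ae_toMeasure_iff _).1 (ae_lt_top .of_discrete ih.ne) x hx
    rw [if_neg (by simpa using hb)] at this
    exact (le_add_self).trans_lt this

open Classical in
/-- The probability that the state `r` is reached from `u`, strictly before the state `s`, both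
after at least one step. It is encoded as a mean cost: the step that ends in `r` costs one. -/
noncomputable def reachBefore (r s u : S) : ℝ≥0∞ :=
  Φ.meanCost {r, s} (fun x => if x.next = r then 1 else 0) u

lemma reachBefore_le_one (r s u : S) : Φ.reachBefore r s u ≤ 1 := by
  refine iSup_le fun n => ?_
  induction n generalizing u with
  | zero => exact zero_le
  | succ n ih =>
    calc _ ≤ ∫⁻ x, 1 ∂(Φ.stepPMF u).toMeasure := by
          refine lintegral_mono fun x => ?_
          dsimp only
          split_ifs with h1 h2 h2
          · simp
          · simp_all
          · simp
          · simpa using ih _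
      _ = 1 := by simp

/-- In an irreducible system there is a positive probability that an excursion from `r` visits a
given other state `s`. -/
lemma IsIrreducible.reachBefore_lt_one {Φ : MatchingPolicy P.graph S} (hΦ : Φ.IsIrreducible)
    {r s : S} (hrs : r ≠ s) : Φ.reachBefore r s r < 1 := by
  refine lt_of_le_of_ne (Φ.reachBefore_le_one r s r) fun h1 => ?_
  -- If the probability were one, all states reachable from `r` would lead to `r` before `s`.
  have inv (u : S) : u ≠ s ∧ Φ.reachBefore r s u = 1 := by
    induction hΦ r u with
    | refl => exact ⟨hrs, h1⟩
    | @tail a b _ hab ih =>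
      obtain ⟨x, hx, rfl⟩ := Φ.transitionPMF_ne_zero_iff.1 hab
      have h2 := ih.2
      rw [reachBefore, meanCost_eq] at h2
      have h3 := ae_eq_of_ae_le_of_lintegral_le (μ := (Φ.stepPMF a).toMeasure) (g := fun _ => 1)
        (Eventually.of_forall fun x => ?_) (h2 ▸ ENNReal.one_ne_top) aemeasurable_const
        (by rw [h2]; simp)
      · have h4 := (PMF.ae_toMeasure_iff _).1 h3 x hx
        by_cases hxr : x.next = r
        · exact hxr.symm ▸ ⟨hrs, h1⟩
        by_cases hxs : x.next = s
        · simp [hxs, hrs.symm] at h4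
        · exact ⟨hxs, by simpa [hxs, hxr, reachBefore] using h4⟩
      · dsimp only
        split_ifs with h1 h2 h2
        · simp
        · simp_all
        · simp
        · rw [zero_add]
          exact Φ.reachBefore_le_one r s x.next
  exact (inv s).1 rfl

/-- The mean time to reach `s` is at most the mean time to reach `r` plus, on the event that `r`
comes first, the mean time to reach `s` from `r`; both times to `s` are truncated. -/
lemma expectedCost_le_add_mul {r s : S} (hrs : r ≠ s) {n N : ℕ} (hn : n ≤ N) (u : S) :
    Φ.expectedCost {s} (fun _ => 1) n u ≤ Φ.meanCost {r} (fun _ => 1) u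
      + Φ.reachBefore r s u * Φ.expectedCost {s} (fun _ => 1) N r := by
  classical
  induction n generalizing u with
  | zero => exact zero_le
  | succ n ih =>
    rw [reachBefore, meanCost_eq, meanCost_eq, ← lintegral_mul_const _ .of_discrete,
      ← lintegral_add_left .of_discrete]
    refine lintegral_mono fun x => ?_
    dsimp only
    by_cases hxs : x.next = s
    · simp only [hxs, Set.mem_singleton_iff, if_true, add_zero]
      exact le_add_right le_self_add
    by_cases hxr : x.next = r
    · simp only [hxr, Set.mem_singleton_iff, hrs, if_true, if_false, add_zero,
        Set.mem_insert_iff, true_or, one_mul]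
      gcongr
      exact Φ.monotone_expectedCost _ _ (by omega) r
    · simp only [Set.mem_singleton_iff, hxs, hxr, if_false, Set.mem_insert_iff, or_self, zero_add,
        add_assoc]
      gcongr
      exact ih (by omega) _

lemma expectedCost_one_le (A : Set S) (n : ℕ) (s : S) :
    Φ.expectedCost A (fun _ => 1) n s ≤ n := by
  induction n generalizing s with
  | zero => simp [expectedCost]
  | succ n ih =>
    calc _ ≤ ∫⁻ x, (1 + n : ℝ≥0∞) ∂(Φ.stepPMF s).toMeasure := by
          refine lintegral_mono fun x => ?_
          dsimp only
          gcongr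
          split_ifs
          · simp
          · exact ih _
      _ = _ := by simp [add_comm]

/-- An irreducible system with finite mean return time to one state is positive recurrent. -/
theorem IsIrreducible.isStable [Countable S] {Φ : MatchingPolicy P.graph S}
    (hΦ : Φ.IsIrreducible) {r : S} (hr : Φ.meanCost {r} (fun _ => 1) r < ∞) : Φ.IsStable := by
  intro s
  rw [lintegral_returnTime]
  by_cases hrs : r = s
  · exact hrs ▸ hr
  have hg := hΦ.reachBefore_lt_one hrs
  set g := Φ.reachBefore r s r
  set h := Φ.meanCost {r} (fun _ => 1) with hdef
  -- The truncated mean time `k` from `r` to `s` satisfies `k ≤ h r + g * k` with `g < 1`.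
  have hk (N : ℕ) : Φ.expectedCost {s} (fun _ => 1) N r ≤ h r / (1 - g) := by
    have hfin : Φ.expectedCost {s} (fun _ => 1) N r ≠ ∞ :=
      ((Φ.expectedCost_one_le _ _ _).trans_lt (ENNReal.natCast_lt_top N)).ne
    rw [ENNReal.le_div_iff_mul_le (Or.inl (tsub_pos_of_lt hg).ne')
      (Or.inl (ENNReal.sub_ne_top ENNReal.one_ne_top)), ENNReal.mul_sub fun _ _ => hfin, mul_one,
      tsub_le_iff_right, mul_comm _ g]
    exact Φ.expectedCost_le_add_mul hrs le_rfl r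
  refine lt_of_le_of_lt (iSup_le fun n => (?_ : _ ≤ h s + h r / (1 - g)))
    (ENNReal.add_lt_top.2 ⟨hΦ.meanCost_lt_top hr s,
      ENNReal.div_lt_top hr.ne (tsub_pos_of_lt hg).ne'⟩)
  refine (Φ.expectedCost_le_add_mul hrs le_rfl s).trans ?_
  gcongr
  exact (mul_le_of_le_one_left' (Φ.reachBefore_le_one r s s)).trans (hk n)

end MatchingPolicy

/-! ### Cycles and the law of large numbers -/

/-- The growth rate of a monotone sequence can be read off along the times `T k` if these grow
linearly. -/
lemma tendsto_div_of_tendsto_subseq {R T : ℕ → ℕ} (hR : Monotone R) (hT : StrictMono T)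
    (hT0 : T 0 = 0) {a m : ℝ} (hm : 0 < m)
    (hTm : Tendsto (fun k : ℕ => (T k : ℝ) / k) atTop (𝓝 m))
    (hRa : Tendsto (fun k : ℕ => (R (T k) : ℝ) / k) atTop (𝓝 a)) :
    Tendsto (fun t : ℕ => (R t : ℝ) / t) atTop (𝓝 (a / m)) := by
  -- `N t` is the number of the `T k`, `k ≥ 1`, up to time `t`.
  let N (t : ℕ) : ℕ := Nat.findGreatest (fun k => T k ≤ t) t
  have hTN (t : ℕ) : T (N t) ≤ t :=
    Nat.findGreatest_spec (P := fun k => T k ≤ t) (Nat.zero_le t) (hT0.trans_le (Nat.zero_le t))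
  have hNT (t : ℕ) : t < T (N t + 1) := by
    by_contra! h
    exact absurd (Nat.le_findGreatest (P := fun k => T k ≤ t) ((hT.id_le _).trans h) h)
      (by simp [N])
  have hN : Tendsto N atTop atTop := by
    refine tendsto_atTop.2 fun k => ?_
    filter_upwards [eventually_ge_atTop (T k)] with t ht
    exact Nat.le_findGreatest ((hT.id_le k).trans ht) ht
  have hk : Tendsto (fun k : ℕ => ((k : ℝ) + 1) / k) atTop (𝓝 1) := by
    have := (tendsto_one_div_atTop_nhds_zero_nat (𝕜 := ℝ)).const_add 1
    rw [add_zero] at this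
    refine this.congr' ?_
    filter_upwards [eventually_gt_atTop 0] with k hk
    field_simp
  have hRs := hRa.comp (tendsto_add_atTop_nat 1)
  have hTs := hTm.comp (tendsto_add_atTop_nat 1)
  have up : Tendsto (fun k : ℕ => (R (T (k + 1)) : ℝ) / T k) atTop (𝓝 (a / m)) := by
    have := (hRs.mul hk).div hTm hm.ne'
    rw [mul_one] at this
    refine this.congr' ?_
    filter_upwards [eventually_gt_atTop 0] with k hk
    simp only [Function.comp_apply, Nat.cast_add, Nat.cast_one, Pi.div_apply]
    have : (0 : ℝ) < T k := by exact_mod_cast hk.trans_le (hT.id_le k)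
    field_simp
  have low : Tendsto (fun k : ℕ => (R (T k) : ℝ) / T (k + 1)) atTop (𝓝 (a / m)) := by
    have := (hRa.div hk one_ne_zero).div hTs hm.ne'
    rw [div_one] at this
    refine this.congr' ?_
    filter_upwards [eventually_gt_atTop 0] with k hk
    simp only [Function.comp_apply, Nat.cast_add, Nat.cast_one, Pi.div_apply]
    have : (0 : ℝ) < T (k + 1) := by exact_mod_cast (Nat.succ_pos k).trans_le (hT.id_le _)
    field_simp
  refine tendsto_of_tendsto_of_tendsto_of_le_of_le' (low.comp hN) (up.comp hN) ?_ ?_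
  · filter_upwards [eventually_gt_atTop 0] with t ht
    have : (0 : ℝ) < t := by exact_mod_cast ht
    have h1 : (T (N t + 1) : ℝ) ≥ t := by exact_mod_cast (hNT t).le
    have h2 : (R (T (N t)) : ℝ) ≤ R t := by exact_mod_cast hR (hTN t)
    simp only [Function.comp_apply]
    gcongr
  · filter_upwards [hN.eventually_gt_atTop 0] with t ht
    have h0 : (0 : ℝ) < T (N t) := by exact_mod_cast ht.trans_le (hT.id_le _)
    have h1 : (T (N t) : ℝ) ≤ t := by exact_mod_cast hTN t
    have h2 : (R t : ℝ) ≤ R (T (N t + 1)) := by exact_mod_cast hR (hNT t).le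
    simp only [Function.comp_apply]
    gcongr

namespace MatchingStep

variable {V S : Type*}

/-- The total reward of the first `n` steps, where the step `x` earns `c x`. -/
def reward (c : MatchingStep V S → ℕ) (n : ℕ) (ω : ℕ → MatchingStep V S) : ℕ :=
  ∑ i ∈ Finset.range n, c (ω i)

/-- The number of steps up to and including the first one that ends in `r` (`1` if no step ends
in `r`). -/
noncomputable def cycleLength (r : S) (ω : ℕ → MatchingStep V S) : ℕ :=
  sInf {n | (ω n).next = r} + 1

/-- The total reward of the steps up to and including the first one that ends in `r`. -/
noncomputable def cycleReward (r : S) (c : MatchingStep V S → ℕ) (ω : ℕ → MatchingStep V S) : ℕ :=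
  reward c (cycleLength r ω) ω

/-- The sequence of the steps made after the first one that ends in `r`. -/
noncomputable def nextCycle (r : S) (ω : ℕ → MatchingStep V S) : ℕ → MatchingStep V S :=
  shift (cycleLength r ω) ω

lemma measurable_eval_next_eq (r : S) (i : ℕ) :
    MeasurableSet {ω : ℕ → MatchingStep V S | (ω i).next = r} := by
  have h : Measurable fun ω : ℕ → MatchingStep V S => ω i := measurable_pi_apply i
  exact h (.of_discrete (s := {x : MatchingStep V S | x.next = r}))

lemma measurableSet_isFirstVisit (r : S) (n : ℕ) :
    MeasurableSet {ω : ℕ → MatchingStep V S | IsFirstVisit r n ω} := by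
  have : {ω : ℕ → MatchingStep V S | IsFirstVisit r n ω}
      = (⋂ i, ⋂ (_ : i < n), {ω | (ω i).next = r}ᶜ) ∩ {ω | (ω n).next = r} := by
    ext ω
    simp [IsFirstVisit]
  rw [this]
  exact (MeasurableSet.iInter fun i => .iInter fun _ => (measurable_eval_next_eq r i).compl).inter
    (measurable_eval_next_eq r n)

lemma IsFirstVisit.cycleLength_eq {r : S} {n : ℕ} {ω : ℕ → MatchingStep V S}
    (h : IsFirstVisit r n ω) : cycleLength r ω = n + 1 := by
  refine congrArg (· + 1) (le_antisymm (Nat.sInf_le h.2) (le_csInf ⟨n, h.2⟩ fun k hk => ?_))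
  exact not_lt.1 fun hlt => h.1 k hlt hk

lemma measurable_cycleLength (r : S) : Measurable (cycleLength (V := V) r) := by
  refine measurable_to_countable' fun k => ?_
  -- The junk value of `sInf ∅` makes the event without visits a part of the level set of `1`.
  rcases k with _ | n
  · convert MeasurableSet.empty
    ext ω
    simp [cycleLength]
  have : cycleLength (V := V) r ⁻¹' {n + 1} = {ω | IsFirstVisit r n ω} ∪
      ((⋂ i, {ω | (ω i).next = r}ᶜ) ∩ {_ω | n = 0}) := by
    ext ω
    simp only [Set.mem_preimage, Set.mem_singleton_iff, Set.mem_union, Set.mem_ofPred_eq,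
      Set.mem_inter_iff, Set.mem_iInter, Set.mem_compl_iff]
    by_cases h : ∃ k, (ω k).next = r
    · obtain ⟨k, hk⟩ := h
      obtain ⟨m, hm⟩ := exists_isFirstVisit hk
      rw [hm.cycleLength_eq, Nat.succ_inj]
      refine ⟨fun h => Or.inl (h ▸ hm), ?_⟩
      rintro (h | h)
      · simpa [hm.cycleLength_eq] using h.cycleLength_eq
      · exact absurd hk (h.1 k)
    · push Not at h
      simp [cycleLength, h, IsFirstVisit]
  rw [this]
  exact (measurableSet_isFirstVisit r n).union
    ((MeasurableSet.iInter fun i => (measurable_eval_next_eq r i).compl).inter (.const _))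

lemma measurable_reward (c : MatchingStep V S → ℕ) (n : ℕ) : Measurable (reward c n) :=
  Finset.measurable_fun_sum _ fun i _ => (Measurable.of_discrete (f := c)).comp
    (measurable_pi_apply i : Measurable fun ω : ℕ → MatchingStep V S => ω i)

lemma measurable_cycleReward (r : S) (c : MatchingStep V S → ℕ) : Measurable (cycleReward r c) :=
  (measurable_from_prod_countable_right (f := fun p : ℕ × (ℕ → MatchingStep V S) =>
    reward c p.1 p.2) (measurable_reward c)).comp ((measurable_cycleLength r).prodMk measurable_id)

lemma measurable_nextCycle (r : S) : Measurable (nextCycle (V := V) r) :=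
  (measurable_from_prod_countable_right (f := fun p : ℕ × (ℕ → MatchingStep V S) =>
    shift p.1 p.2) measurable_shift).comp ((measurable_cycleLength r).prodMk measurable_id)

lemma reward_add (c : MatchingStep V S → ℕ) (m n : ℕ) (ω : ℕ → MatchingStep V S) :
    reward c (m + n) ω = reward c m ω + reward c n (shift m ω) := by
  simp only [reward, Finset.sum_range_add, shift, add_comm]

lemma monotone_reward (c : MatchingStep V S → ℕ) (ω : ℕ → MatchingStep V S) :
    Monotone fun n => reward c n ω := by
  refine monotone_nat_of_le_succ fun n => ?_
  simp [reward, Finset.sum_range_succ]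

lemma iterate_nextCycle (r : S) (k : ℕ) (ω : ℕ → MatchingStep V S) :
    (nextCycle r)^[k] ω
      = shift (∑ j ∈ Finset.range k, cycleLength r ((nextCycle r)^[j] ω)) ω := by
  induction k with
  | zero => rfl
  | succ k ih =>
    rw [Function.iterate_succ_apply', nextCycle, Finset.sum_range_succ]
    nth_rewrite 2 [ih]
    ext i
    simp only [shift]
    congr 1
    ring

lemma reward_sum_cycleLength (r : S) (c : MatchingStep V S → ℕ) (k : ℕ)
    (ω : ℕ → MatchingStep V S) :
    reward c (∑ j ∈ Finset.range k, cycleLength r ((nextCycle r)^[j] ω)) ω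
      = ∑ j ∈ Finset.range k, cycleReward r c ((nextCycle r)^[j] ω) := by
  induction k with
  | zero => rfl
  | succ k ih =>
    rw [Finset.sum_range_succ, Finset.sum_range_succ, reward_add, ih, ← iterate_nextCycle]
    rfl

end MatchingStep

namespace MatchingPolicy

open MatchingStep

variable {V : Type*} [DecidableEq V] [Fintype V] [Nonempty V] {S : Type*}
  {P : MatchingProblem V} (Φ : MatchingPolicy P.graph S)

/-- The Markov property at time `n`, on an event on which the state at that time is `r`. The factor
`G` depends on the first `n` steps only and vanishes outside of that event. -/
lemma lintegral_mul_shift [Countable S] {r : S} {F : (ℕ → MatchingStep V S) → ℝ≥0∞}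
    (hF : Measurable F) {n : ℕ} {s : S} {G : (ℕ → MatchingStep V S) → ℝ≥0∞} (hG : Measurable G)
    (hdep : ∀ ω ω', (∀ i < n, ω i = ω' i) → G ω = G ω') (hr : ∀ ω, state s ω n ≠ r → G ω = 0) :
    ∫⁻ ω, G ω * F (shift n ω) ∂Φ.law s = (∫⁻ ω, G ω ∂Φ.law s) * ∫⁻ ω, F ω ∂Φ.law r := by
  induction n generalizing s G with
  | zero =>
    obtain ⟨ω₀⟩ : Nonempty (ℕ → MatchingStep V S) := (Φ.law s).nonempty_of_neZero
    have hG0 : G = fun _ => G ω₀ := funext fun ω => hdep _ _ (by simp)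
    by_cases hs : s = r
    · subst hs
      have h0 (ω : ℕ → MatchingStep V S) : shift 0 ω = ω := rfl
      rw [hG0]
      simp only [h0]
      rw [lintegral_const_mul _ hF]
      simp
    · simp [hr _ hs]
  | succ n ih =>
    have hGF : Measurable fun ω => G ω * F (shift (n + 1) ω) :=
      hG.mul (hF.comp (measurable_shift _))
    rw [Φ.lintegral_law s hGF, Φ.lintegral_law s hG,
      ← lintegral_mul_const _ .of_discrete]
    refine lintegral_congr fun x => ?_
    refine ih (hG.comp (measurable_cons x)) (fun ω ω' h => hdep _ _ fun i hi => ?_) fun ω hω => ?_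
    · cases i with
      | zero => rfl
      | succ i => exact h i (by omega)
    · exact hr _ (by rwa [state_cons_succ])

lemma ae_exists_isFirstVisit [Countable S] {r : S} (hr : Φ.meanCost {r} (fun _ => 1) r < ∞) :
    ∀ᵐ ω ∂Φ.law r, ∃ n, IsFirstVisit r n ω := by
  have hm : Measurable (returnTime (V := V) r) := by
    have : returnTime (V := V) r = fun ω => ⨆ n, stopSum {r} (fun _ => 1) n ω :=
      funext (returnTime_eq_iSup_stopSum r)
    rw [this]
    exact .iSup (measurable_stopSum _ _)
  rw [← lintegral_returnTime] at hr
  filter_upwards [ae_lt_top hm hr.ne] with ω hω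
  by_contra! h
  refine hω.ne (iInf_eq_top.2 fun t => iInf_eq_top.2 fun ht => ?_)
  obtain ⟨ht1, hts⟩ := ht
  obtain ⟨t, rfl⟩ := Nat.exists_eq_add_of_le' ht1
  obtain ⟨n, hn⟩ := exists_isFirstVisit (show (ω t).next = r from hts)
  exact absurd hn (h n)

/-- The strong Markov property at the first return to `r`. -/
lemma lintegral_cycleReward_mul [Countable S] {r : S}
    (hr : Φ.meanCost {r} (fun _ => 1) r < ∞) (c : MatchingStep V S → ℕ) (g : ℕ → ℝ≥0∞)
    {F : (ℕ → MatchingStep V S) → ℝ≥0∞} (hF : Measurable F) :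
    ∫⁻ ω, g (cycleReward r c ω) * F (nextCycle r ω) ∂Φ.law r
      = (∫⁻ ω, g (cycleReward r c ω) ∂Φ.law r) * ∫⁻ ω, F ω ∂Φ.law r := by
  have hdisj : Pairwise (Function.onFun Disjoint
      fun n => {ω : ℕ → MatchingStep V S | IsFirstVisit r n ω}) := fun m n hmn =>
    Set.disjoint_left.2 fun ω h1 h2 => hmn <| Nat.succ_injective <|
      (IsFirstVisit.cycleLength_eq h1).symm.trans (IsFirstVisit.cycleLength_eq h2)
  have hsum (H : (ℕ → MatchingStep V S) → ℝ≥0∞) :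
      ∫⁻ ω, H ω ∂Φ.law r = ∑' n, ∫⁻ ω, {ω | IsFirstVisit r n ω}.indicator H ω ∂Φ.law r := by
    have huniv : (⋃ n, {ω | IsFirstVisit r n ω} : Set (ℕ → MatchingStep V S)) =ᵐ[Φ.law r]
        Set.univ := by
      rw [eventuallyEq_univ]
      filter_upwards [Φ.ae_exists_isFirstVisit hr] with ω hω
      simpa using hω
    rw [← setLIntegral_univ, ← setLIntegral_congr huniv,
      lintegral_iUnion (measurableSet_isFirstVisit r) hdisj]
    simp_rw [lintegral_indicator (measurableSet_isFirstVisit r _)]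
  rw [hsum, hsum fun ω => g (cycleReward r c ω), ← ENNReal.tsum_mul_right]
  refine tsum_congr fun n => ?_
  have h1 : (fun ω => {ω | IsFirstVisit r n ω}.indicator
      (fun ω => g (cycleReward r c ω) * F (nextCycle r ω)) ω) = fun ω =>
      {ω | IsFirstVisit r n ω}.indicator (fun ω => g (reward c (n + 1) ω)) ω
        * F (shift (n + 1) ω) := by
    ext ω
    by_cases h : IsFirstVisit r n ω
    · simp [h, cycleReward, nextCycle, h.cycleLength_eq]
    · simp [h]
  have h2 : (fun ω => {ω | IsFirstVisit r n ω}.indicator (fun ω => g (cycleReward r c ω)) ω)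
      = fun ω => {ω | IsFirstVisit r n ω}.indicator (fun ω => g (reward c (n + 1) ω)) ω := by
    ext ω
    by_cases h : IsFirstVisit r n ω
    · simp [h, cycleReward, h.cycleLength_eq]
    · simp [h]
  rw [h1, h2]
  refine Φ.lintegral_mul_shift hF
    ((Measurable.of_discrete.comp (measurable_reward c (n + 1))).indicator
      (measurableSet_isFirstVisit r n)) (fun ω ω' h => ?_) fun ω hω => ?_
  · have hiff : IsFirstVisit r n ω ↔ IsFirstVisit r n ω' :=
      and_congr (forall₂_congr fun i hi => by rw [h i (by omega)]) (by rw [h n (by omega)])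
    have hrew : reward c (n + 1) ω = reward c (n + 1) ω' :=
      Finset.sum_congr rfl fun i hi => by rw [h i (Finset.mem_range.1 hi)]
    by_cases hv : IsFirstVisit r n ω
    · simp [hv, hiff.1 hv, hrew]
    · simp [hv, mt hiff.2 hv]
  · exact Set.indicator_of_notMem (fun h => hω h.2) _

/-- The process that starts with the second cycle has the law of the whole process. -/
lemma measurePreserving_nextCycle [Countable S] {r : S}
    (hr : Φ.meanCost {r} (fun _ => 1) r < ∞) :
    MeasurePreserving (nextCycle r) (Φ.law r) (Φ.law r) := by
  refine ⟨measurable_nextCycle r, Measure.ext fun B hB => ?_⟩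
  have h := Φ.lintegral_cycleReward_mul hr 0 1 (F := B.indicator 1) (measurable_one.indicator hB)
  rw [Measure.map_apply (measurable_nextCycle r) hB, ← lintegral_indicator_one hB,
    ← lintegral_indicator_one (measurable_nextCycle r hB)]
  simp only [Pi.one_apply, one_mul, lintegral_one, measure_univ] at h
  exact h

/-- The rewards of the first cycle are independent of what happens in the cycles after it. -/
lemma indepFun_cycleReward [Countable S] {r : S} (hr : Φ.meanCost {r} (fun _ => 1) r < ∞)
    (c : MatchingStep V S → ℕ) {Y : (ℕ → MatchingStep V S) → ℕ} (hY : Measurable Y) :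
    IndepFun (cycleReward r c) (Y ∘ nextCycle r) (Φ.law r) := by
  rw [indepFun_iff_measure_inter_preimage_eq_mul]
  intro s t hs ht
  have hX := measurable_cycleReward r c hs
  have hYt := hY ht
  have hθ := measurable_nextCycle r hYt
  have h := Φ.lintegral_cycleReward_mul hr c (s.indicator 1) (F := (Y ⁻¹' t).indicator 1)
    (measurable_one.indicator hYt)
  rw [lintegral_indicator_one hYt, ← (Φ.measurePreserving_nextCycle hr).measure_preimage
    hYt.nullMeasurableSet] at h
  rw [Set.preimage_comp, ← lintegral_indicator_one (hX.inter hθ), ← lintegral_indicator_one hX,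
    Set.inter_indicator_one]
  exact h

lemma lintegral_cycleReward [Countable S] {r : S} (hr : Φ.meanCost {r} (fun _ => 1) r < ∞)
    (c : MatchingStep V S → ℕ) :
    ∫⁻ ω, (cycleReward r c ω : ℝ≥0∞) ∂Φ.law r = Φ.meanCost {r} (fun x => c x) r := by
  rw [← lintegral_iSup_stopSum]
  refine lintegral_congr_ae ?_
  filter_upwards [Φ.ae_exists_isFirstVisit hr] with ω hω
  obtain ⟨n, hn⟩ := hω
  rw [iSup_stopSum_eq_sum hn, cycleReward, hn.cycleLength_eq, reward]
  push_cast
  rfl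

lemma meanCost_mono {A : Set S} {c c' : MatchingStep V S → ℝ≥0∞} (h : c ≤ c') (s : S) :
    Φ.meanCost A c s ≤ Φ.meanCost A c' s := by
  refine iSup_mono fun n => ?_
  induction n generalizing s with
  | zero => exact le_rfl
  | succ n ih =>
    refine lintegral_mono fun x => add_le_add (h x) ?_
    split_ifs
    · exact le_rfl
    · exact ih _

lemma one_le_meanCost_one (A : Set S) (s : S) : 1 ≤ Φ.meanCost A (fun _ => 1) s := by
  rw [meanCost_eq]
  calc (1 : ℝ≥0∞) = ∫⁻ x, 1 ∂(Φ.stepPMF s).toMeasure := by simp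
    _ ≤ _ := lintegral_mono fun x => le_self_add

/-- The strong law of large numbers for the rewards of the successive cycles. -/
lemma ae_tendsto_sum_cycleReward [Countable S] {r : S}
    (hr : Φ.meanCost {r} (fun _ => 1) r < ∞) {c : MatchingStep V S → ℕ} (hc : ∀ x, c x ≤ 1) :
    ∀ᵐ ω ∂Φ.law r, Tendsto (fun k : ℕ =>
      (∑ j ∈ Finset.range k, (cycleReward r c ((nextCycle r)^[j] ω) : ℝ)) / k) atTop
      (𝓝 (Φ.meanCost {r} (fun x => c x) r).toReal) := by
  have hθ (k : ℕ) := (Φ.measurePreserving_nextCycle hr).iterate k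
  have hX : Measurable (cycleReward r c) := measurable_cycleReward r c
  have hcast : Measurable (Nat.cast : ℕ → ℝ) := .of_discrete
  have hlt : Φ.meanCost {r} (fun x => c x) r < ∞ :=
    (Φ.meanCost_mono (fun x => by simpa using hc x) r).trans_lt hr
  have hlint : ∫⁻ ω, ENNReal.ofReal (cycleReward r c ω : ℝ) ∂Φ.law r
      = Φ.meanCost {r} (fun x => c x) r := by
    simp_rw [ENNReal.ofReal_natCast]
    exact Φ.lintegral_cycleReward hr c
  have hint : Integrable (fun ω => (cycleReward r c ω : ℝ)) (Φ.law r) := by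
    refine ⟨(hcast.comp hX).aestronglyMeasurable, ?_⟩
    rw [hasFiniteIntegral_iff_ofReal (Eventually.of_forall fun ω => Nat.cast_nonneg _), hlint]
    exact hlt
  have hlim : ∫ ω, (cycleReward r c ω : ℝ) ∂Φ.law r
      = (Φ.meanCost {r} (fun x => c x) r).toReal := by
    rw [integral_eq_lintegral_of_nonneg_ae (Eventually.of_forall fun ω => Nat.cast_nonneg _)
      hint.1, hlint]
  -- The shift by `i` cycles preserves the law, which reduces the claim to the first cycle and one
  -- of the later ones.
  have hlt_indep {i j : ℕ} (hij : i < j) : IndepFun (fun ω => cycleReward r c ((nextCycle r)^[i] ω))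
      (fun ω => cycleReward r c ((nextCycle r)^[j] ω)) (Φ.law r) := by
    obtain ⟨k, rfl⟩ := Nat.exists_eq_add_of_le' (Nat.succ_le_of_lt hij)
    have h := Φ.indepFun_cycleReward hr c (hX.comp (hθ k).measurable)
    rw [indepFun_iff_measure_inter_preimage_eq_mul] at h ⊢
    intro s t hs ht
    have hXs := hX hs
    have hYt := ((hX.comp (hθ k).measurable).comp (measurable_nextCycle r)) ht
    have h1 := h s t hs ht
    rw [← (hθ i).measure_preimage hXs.nullMeasurableSet,
      ← (hθ i).measure_preimage hYt.nullMeasurableSet,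
      ← (hθ i).measure_preimage (hXs.inter hYt).nullMeasurableSet] at h1
    have hiter : (fun ω => cycleReward r c ((nextCycle r)^[k + (i + 1)] ω))
        = ((cycleReward r c ∘ (nextCycle r)^[k]) ∘ nextCycle r) ∘ (nextCycle r)^[i] := by
      ext ω
      simp only [Function.comp_apply]
      rw [← Function.iterate_succ_apply' (nextCycle r), ← Function.iterate_add_apply]
    rw [hiter]
    exact h1
  have key := strong_law_ae_real
    (fun j ω => (cycleReward r c ((nextCycle r)^[j] ω) : ℝ)) (μ := Φ.law r) hint ?_ fun j => ?_
  · simpa [hlim] using key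
  · intro i j hij
    rcases lt_or_gt_of_ne hij with h | h
    · exact (hlt_indep h).comp hcast hcast
    · exact ((hlt_indep h).comp hcast hcast).symm
  · have hm := hcast.comp hX
    refine ⟨(hm.comp (hθ j).measurable).aemeasurable, hm.aemeasurable, ?_⟩
    rw [← Function.comp_def (fun ω => (cycleReward r c ω : ℝ)) ((nextCycle r)^[j])]
    exact (Measure.map_map hm (hθ j).measurable).symm.trans (by rw [(hθ j).map_eq]; rfl)

/-- The cycle formula: the long-run reward per step is the mean reward of a cycle divided by the
mean length of a cycle. -/
theorem ae_tendsto_reward_div [Countable S] {r : S}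
    (hr : Φ.meanCost {r} (fun _ => 1) r < ∞) {c : MatchingStep V S → ℕ} (hc : ∀ x, c x ≤ 1) :
    ∀ᵐ ω ∂Φ.law r, Tendsto (fun t : ℕ => (reward c t ω : ℝ) / t) atTop
      (𝓝 ((Φ.meanCost {r} (fun x => c x) r).toReal
        / (Φ.meanCost {r} (fun _ => 1) r).toReal)) := by
  have hlen (ω : ℕ → MatchingStep V S) : cycleReward r (fun _ => 1) ω = cycleLength r ω := by
    simp [cycleReward, reward]
  filter_upwards [Φ.ae_tendsto_sum_cycleReward hr hc,
    Φ.ae_tendsto_sum_cycleReward hr (c := fun _ => 1) fun _ => le_rfl] with ω h1 h2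
  simp only [hlen, Nat.cast_one] at h2
  refine tendsto_div_of_tendsto_subseq (monotone_reward c ω)
    (T := fun k => ∑ j ∈ Finset.range k, cycleLength r ((nextCycle r)^[j] ω))
    (strictMono_nat_of_lt_succ fun k => ?_) rfl
    (ENNReal.toReal_pos (one_pos.trans_le (Φ.one_le_meanCost_one _ _)).ne' hr.ne) ?_ ?_
  · simp [Finset.sum_range_succ, cycleLength]
  · simpa using h2
  · simpa [reward_sum_cycleLength] using h1

end MatchingPolicy

/-! ### Mixtures of policies -/

namespace MatchingStep

variable {V S S' : Type*}

/-- Renaming of the states along `f`. -/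
def mapNext (f : S → S') (x : MatchingStep V S) : MatchingStep V S' :=
  ⟨x.arrival, x.decision, f x.next⟩

open Classical in
/-- The number of matches along the edge `e` made in a step: `1` or `0`. -/
noncomputable def matchReward (e : Sym2 V) (x : MatchingStep V S) : ℕ :=
  if ∃ j, x.decision = some j ∧ s(x.arrival, j) = e then 1 else 0

lemma matchReward_le_one (e : Sym2 V) (x : MatchingStep V S) : matchReward e x ≤ 1 := by
  unfold matchReward
  split_ifs <;> simp

lemma matchCount_eq_reward (e : Sym2 V) (ω : ℕ → MatchingStep V S) (t : ℕ) :
    matchCount e ω t = reward (matchReward e) t ω := by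
  classical
  rw [matchCount, Finset.card_filter, reward]
  exact Finset.sum_congr rfl fun i _ => by simp only [matchReward]

end MatchingStep

lemma PMF.lintegral_toMeasure {α : Type*} [Countable α] [MeasurableSpace α]
    [DiscreteMeasurableSpace α] (p : PMF α) (f : α → ℝ≥0∞) :
    ∫⁻ x, f x ∂p.toMeasure = ∑' x, p x * f x := by
  rw [lintegral_countable']
  refine tsum_congr fun x => ?_
  rw [PMF.toMeasure_apply_singleton _ _ (measurableSet_singleton x), mul_comm]

lemma PMF.lintegral_toMeasure_bind {α β : Type*} [Countable α] [MeasurableSpace α]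
    [DiscreteMeasurableSpace α] (q : PMF β) (p : β → PMF α) (f : α → ℝ≥0∞) :
    ∫⁻ x, f x ∂(q.bind p).toMeasure = ∑' b, q b * ∫⁻ x, f x ∂(p b).toMeasure := by
  simp_rw [PMF.lintegral_toMeasure, PMF.bind_apply, ← ENNReal.tsum_mul_left,
    ← ENNReal.tsum_mul_right]
  rw [ENNReal.tsum_comm]
  simp_rw [mul_assoc]

namespace MatchingPolicy

open MatchingStep

section Mixture

variable {V : Type*} [DecidableEq V] {G : SimpleGraph V} {B : Type*} {S : B → Type*}
  (Φ : ∀ b, MatchingPolicy G (S b)) (q : PMF B)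

/-- The states of the mixture of the policies `Φ b`: the disjoint union of their state spaces, with
all the empty states identified to one state, `none`. -/
abbrev MixState : Type _ := Option (Σ b, {s : S b // s ≠ (Φ b).empty})

open Classical in
/-- The inclusion of the state space of `Φ b` into that of the mixture. -/
noncomputable def mixEmbed (b : B) (s : S b) : MixState Φ :=
  if h : s = (Φ b).empty then none else some ⟨b, s, h⟩

lemma mixEmbed_empty (b : B) : mixEmbed Φ b (Φ b).empty = none := dif_pos rfl

lemma mixEmbed_of_ne {b : B} {s : S b} (h : s ≠ (Φ b).empty) :
    mixEmbed Φ b s = some ⟨b, s, h⟩ := dif_neg h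

lemma mixEmbed_eq_none_iff {b : B} {s : S b} : mixEmbed Φ b s = none ↔ s = (Φ b).empty := by
  by_cases h : s = (Φ b).empty
  · simp [h, mixEmbed_empty]
  · simp [h, mixEmbed_of_ne]

lemma mixEmbed_injective (b : B) : Function.Injective (mixEmbed Φ b) := by
  intro s t h
  by_cases ht : t = (Φ b).empty
  · rw [ht, mixEmbed_empty, mixEmbed_eq_none_iff] at h
    rw [h, ht]
  · have hs : s ≠ (Φ b).empty := fun hs =>
      ht ((mixEmbed_eq_none_iff Φ).1 (by rw [← h, hs, mixEmbed_empty]))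
    simpa [mixEmbed_of_ne Φ hs, mixEmbed_of_ne Φ ht] using h

lemma exists_mixEmbed_eq [Nonempty B] (x : MixState Φ) : ∃ b s, mixEmbed Φ b s = x := by
  cases x with
  | none =>
    obtain ⟨b⟩ := ‹Nonempty B›
    exact ⟨b, _, mixEmbed_empty Φ b⟩
  | some x => exact ⟨x.1, x.2, mixEmbed_of_ne Φ x.2.2⟩

/-- The number of unmatched items in a state of the mixture. -/
def mixSize : MixState Φ → V → ℕ
  | none => 0
  | some x => (Φ x.1).size x.2

lemma mixSize_mixEmbed (b : B) (s : S b) : mixSize Φ (mixEmbed Φ b s) = (Φ b).size s := by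
  by_cases h : s = (Φ b).empty
  · rw [h, mixEmbed_empty, mixSize, ((Φ b).size_eq_zero_iff _).2 rfl]
  · rw [mixEmbed_of_ne Φ h, mixSize]

/-- The decisions of the mixture: outside of the empty state the current policy is followed, and in
the empty state the policy is drawn anew from `q`. -/
noncomputable def mixKernel : MixState Φ → V → PMF (Option V × MixState Φ)
  | none, i => q.bind fun b => ((Φ b).kernel (Φ b).empty i).map (Prod.map id (mixEmbed Φ b))
  | some x, i => ((Φ x.1).kernel x.2 i).map (Prod.map id (mixEmbed Φ x.1))

lemma exists_of_mixKernel_ne_zero {x : MixState Φ} {i : V} {j : Option V} {y : MixState Φ}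
    (h : mixKernel Φ q x i (j, y) ≠ 0) :
    ∃ b s s', mixEmbed Φ b s = x ∧ mixEmbed Φ b s' = y ∧ (Φ b).kernel s i (j, s') ≠ 0 := by
  rw [← PMF.mem_support_iff] at h
  cases x with
  | none =>
    simp only [mixKernel, PMF.mem_support_bind_iff, PMF.mem_support_map_iff] at h
    obtain ⟨b, -, ⟨j', s'⟩, hs', heq⟩ := h
    obtain ⟨rfl, rfl⟩ := Prod.mk.inj heq
    exact ⟨b, _, s', mixEmbed_empty Φ b, rfl, hs'⟩
  | some x =>
    simp only [mixKernel, PMF.mem_support_map_iff] at h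
    obtain ⟨⟨j', s'⟩, hs', heq⟩ := h
    obtain ⟨rfl, rfl⟩ := Prod.mk.inj heq
    exact ⟨x.1, x.2, s', mixEmbed_of_ne Φ x.2.2, rfl, hs'⟩

/-- The mixture of the policies `Φ b`: each time the system is empty, one of the policies is drawn
from `q`, and it is followed until the system is empty again. -/
noncomputable def mix : MatchingPolicy G (MixState Φ) where
  size := mixSize Φ
  empty := none
  size_eq_zero_iff x := by
    cases x with
    | none => simp [mixSize]
    | some x => simpa [mixSize, (Φ x.1).size_eq_zero_iff] using x.2.2
  kernel := mixKernel Φ q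
  consistent_none x i y h := by
    obtain ⟨b, s, s', rfl, rfl, hk⟩ := exists_of_mixKernel_ne_zero Φ q h
    simpa only [mixSize_mixEmbed] using (Φ b).consistent_none s i s' hk
  adapted x i j y h := by
    obtain ⟨b, s, s', rfl, rfl, hk⟩ := exists_of_mixKernel_ne_zero Φ q h
    simpa only [mixSize_mixEmbed] using (Φ b).adapted s i j s' hk
  consistent_some x i j y h := by
    obtain ⟨b, s, s', rfl, rfl, hk⟩ := exists_of_mixKernel_ne_zero Φ q h
    simpa only [mixSize_mixEmbed] using (Φ b).consistent_some s i j s' hk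

lemma isGreedy_mix (h : ∀ b, (Φ b).IsGreedy) : (mix Φ q).IsGreedy := by
  rintro x i ⟨j, hij, hj⟩
  refine ENNReal.tsum_eq_zero.2 fun y => ?_
  by_contra hne
  obtain ⟨b, s, s', rfl, rfl, hk⟩ := exists_of_mixKernel_ne_zero Φ q hne
  refine hk (ENNReal.tsum_eq_zero.1 (h b s i ⟨j, hij, ?_⟩) s')
  rwa [← mixSize_mixEmbed]

end Mixture

variable {V : Type*} [DecidableEq V] [Fintype V] [Nonempty V] {P : MatchingProblem V}
  {B : Type*} {S : B → Type*} (Φ : ∀ b, MatchingPolicy P.graph (S b)) (q : PMF B)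

lemma stepPMF_mix_of_ne {b : B} {s : S b} (h : s ≠ (Φ b).empty) :
    (mix Φ q).stepPMF (mixEmbed Φ b s) = ((Φ b).stepPMF s).map (mapNext (mixEmbed Φ b)) := by
  rw [mixEmbed_of_ne Φ h, stepPMF, stepPMF, PMF.map_bind]
  congr 1
  ext1 i
  simp only [mix, mixKernel, PMF.map_comp]
  rfl

lemma stepPMF_mix_none :
    (mix Φ q).stepPMF none
      = q.bind fun b => ((Φ b).stepPMF (Φ b).empty).map (mapNext (mixEmbed Φ b)) := by
  simp only [stepPMF, PMF.map_bind]
  rw [PMF.bind_comm]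
  congr 1
  ext1 i
  simp only [mix, mixKernel, PMF.map_bind, PMF.map_comp]
  rfl

variable {Φ q} in
lemma isIrreducible_mix [Nonempty B] (hq : ∀ b, q b ≠ 0) (h : ∀ b, (Φ b).IsIrreducible) :
    (mix Φ q).IsIrreducible := by
  have hstep (b : B) (s s' : S b) (hs : (Φ b).transitionPMF s s' ≠ 0) :
      (mix Φ q).transitionPMF (mixEmbed Φ b s) (mixEmbed Φ b s') ≠ 0 := by
    obtain ⟨x, hx, rfl⟩ := ((Φ b).transitionPMF_ne_zero_iff).1 hs
    refine ((mix Φ q).transitionPMF_ne_zero_iff).2 ⟨mapNext (mixEmbed Φ b) x, ?_, rfl⟩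
    by_cases h0 : s = (Φ b).empty
    · rw [h0, mixEmbed_empty, stepPMF_mix_none, ← PMF.mem_support_iff, PMF.mem_support_bind_iff]
      exact ⟨b, hq b, (PMF.mem_support_map_iff _ _ _).2 ⟨x, h0 ▸ hx, rfl⟩⟩
    · rw [stepPMF_mix_of_ne Φ q h0, ← PMF.mem_support_iff]
      exact (PMF.mem_support_map_iff _ _ _).2 ⟨x, hx, rfl⟩
  intro x y
  obtain ⟨b, s, rfl⟩ := exists_mixEmbed_eq Φ x
  obtain ⟨b', s', rfl⟩ := exists_mixEmbed_eq Φ y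
  -- Every path can be led through the empty state, where the policy can be changed.
  have h1 := (h b s (Φ b).empty).lift (p := fun x y => (mix Φ q).transitionPMF x y ≠ 0)
    (mixEmbed Φ b) (fun s s' => hstep b s s')
  have h2 := (h b' (Φ b').empty s').lift (p := fun x y => (mix Φ q).transitionPMF x y ≠ 0)
    (mixEmbed Φ b') (fun s s' => hstep b' s s')
  rw [Function.onFun, mixEmbed_empty] at h1 h2
  exact h1.trans h2

/-- Away from the empty state the mixture behaves as the current policy until the system is empty
again. -/
lemma expectedCost_mix_of_ne (c : MatchingStep V (MixState Φ) → ℝ≥0∞) (n : ℕ) {b : B} {s : S b}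
    (h : s ≠ (Φ b).empty) :
    (mix Φ q).expectedCost {none} c n (mixEmbed Φ b s)
      = (Φ b).expectedCost {(Φ b).empty} (c ∘ mapNext (mixEmbed Φ b)) n s := by
  induction n generalizing s with
  | zero => rfl
  | succ n ih =>
    rw [expectedCost, expectedCost, stepPMF_mix_of_ne Φ q h,
      ← PMF.toMeasure_map _ _ .of_discrete, lintegral_map .of_discrete .of_discrete]
    refine lintegral_congr fun x => ?_
    have hiff : (mapNext (mixEmbed Φ b) x).next ∈ ({none} : Set (MixState Φ))
        ↔ x.next ∈ ({(Φ b).empty} : Set (S b)) := mixEmbed_eq_none_iff Φ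
    by_cases hx : x.next ∈ ({(Φ b).empty} : Set (S b))
    · rw [if_pos hx, if_pos (hiff.2 hx)]
      rfl
    · rw [if_neg hx, if_neg (mt hiff.1 hx), mapNext, ih hx]
      rfl

variable [Countable B] [∀ b, Countable (S b)]

lemma expectedCost_mix_none (c : MatchingStep V (MixState Φ) → ℝ≥0∞) (n : ℕ) :
    (mix Φ q).expectedCost {none} c n none = ∑' b, q b *
      (Φ b).expectedCost {(Φ b).empty} (c ∘ mapNext (mixEmbed Φ b)) n (Φ b).empty := by
  cases n with
  | zero => simp [expectedCost]
  | succ n =>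
    rw [expectedCost, stepPMF_mix_none, PMF.lintegral_toMeasure_bind]
    refine tsum_congr fun b => ?_
    rw [← PMF.toMeasure_map _ _ .of_discrete, lintegral_map .of_discrete .of_discrete, expectedCost]
    congr 1
    refine lintegral_congr fun x => ?_
    have hiff : (mapNext (mixEmbed Φ b) x).next ∈ ({none} : Set (MixState Φ))
        ↔ x.next ∈ ({(Φ b).empty} : Set (S b)) := mixEmbed_eq_none_iff Φ
    by_cases hx : x.next ∈ ({(Φ b).empty} : Set (S b))
    · rw [if_pos hx, if_pos (hiff.2 hx)]
      rfl
    · rw [if_neg hx, if_neg (mt hiff.1 hx), mapNext, expectedCost_mix_of_ne Φ q c n hx]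
      rfl

end MatchingPolicy

namespace MatchingPolicy

open MatchingStep

variable {V : Type*} [DecidableEq V] [Fintype V] [Nonempty V] {P : MatchingProblem V}

/-- The mean reward of a cycle of the mixture is the `q`-average of the mean rewards of the cycles
of the policies it consists of. -/
lemma meanCost_mix_none {B : Type*} [Fintype B] {S : B → Type*} [∀ b, Countable (S b)]
    (Φ : ∀ b, MatchingPolicy P.graph (S b)) (q : PMF B) (c : MatchingStep V (MixState Φ) → ℝ≥0∞) :
    (mix Φ q).meanCost {none} c none = ∑ b, q b *
      (Φ b).meanCost {(Φ b).empty} (c ∘ mapNext (mixEmbed Φ b)) (Φ b).empty := by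
  simp_rw [meanCost, expectedCost_mix_none, tsum_fintype, ENNReal.mul_iSup]
  rw [ENNReal.finsetSum_iSup_of_monotone]
  exact fun b m n h => mul_le_mul_right ((Φ b).monotone_expectedCost _ _ h _) _

/-! ### Matching rates of mixtures -/

section CycleMeans

variable {S : Type*} (Φ : MatchingPolicy P.graph S)

/-- The mean length of a cycle, that is, the mean return time to the empty state. -/
noncomputable def cycleMean : ℝ≥0∞ := Φ.meanCost {Φ.empty} (fun _ => 1) Φ.empty

/-- The mean number of matches along the edge `e` during a cycle. -/
noncomputable def matchMean (e : Sym2 V) : ℝ≥0∞ :=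
  Φ.meanCost {Φ.empty} (fun x => matchReward e x) Φ.empty

variable {Φ}

lemma IsStable.cycleMean_lt_top [Countable S] (h : Φ.IsStable) : Φ.cycleMean < ∞ := by
  rw [cycleMean, ← lintegral_returnTime]
  exact h _

lemma matchMean_lt_top (h : Φ.cycleMean < ∞) (e : Sym2 V) : Φ.matchMean e < ∞ :=
  (Φ.meanCost_mono (fun x => by simpa using matchReward_le_one e x) _).trans_lt h

lemma cycleMean_toReal_pos (h : Φ.cycleMean < ∞) : 0 < Φ.cycleMean.toReal :=
  ENNReal.toReal_pos (one_pos.trans_le (Φ.one_le_meanCost_one _ _)).ne' h.ne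

/-- The matching rates of a stable policy are the mean numbers of matches in a cycle per unit of
time. -/
lemma hasMatchingRates_iff [Countable S] (h : Φ.cycleMean < ∞) {μ : P.graph.edgeSet → ℝ} :
    Φ.HasMatchingRates μ ↔ ∀ e : P.graph.edgeSet,
      μ e = (∑ i, P.rate i) * ((Φ.matchMean e).toReal / Φ.cycleMean.toReal) := by
  refine forall_congr' fun e => ?_
  have hlim := Φ.ae_tendsto_reward_div h (matchReward_le_one (S := S) (e : Sym2 V))
  simp_rw [matchCount_eq_reward]
  constructor
  · intro hμ
    obtain ⟨ω, h1, h2⟩ := (hμ.and hlim).exists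
    exact tendsto_nhds_unique h1 (h2.const_mul _)
  · intro hμ
    filter_upwards [hlim] with ω hω
    rw [hμ]
    exact hω.const_mul _

end CycleMeans

/-- A convex combination `∑ b, β b • μ b` of matching-rate vectors of stable policies is achieved
by a mixture of these policies. -/
theorem exists_mix_hasMatchingRates {B : Type*} [Fintype B] [Nonempty B] {S : B → Type*}
    [∀ b, Countable (S b)] {Φ : ∀ b, MatchingPolicy P.graph (S b)}
    (hirr : ∀ b, (Φ b).IsIrreducible) (hst : ∀ b, (Φ b).IsStable)
    {μ : B → P.graph.edgeSet → ℝ} (hμ : ∀ b, (Φ b).HasMatchingRates (μ b))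
    {β : B → ℝ} (hβ : ∀ b, 0 < β b) (hsum : ∑ b, β b = 1) :
    ∃ q : PMF B, (mix Φ q).IsIrreducible ∧ (mix Φ q).IsStable ∧
      (mix Φ q).HasMatchingRates (∑ b, β b • μ b) := by
  have hfin (b : B) := (hst b).cycleMean_lt_top
  have hpos (b : B) := cycleMean_toReal_pos (hfin b)
  set ℓ : B → ℝ := fun b => (Φ b).cycleMean.toReal
  -- The fraction of time spent on the policy `b` is proportional to the probability of choosing
  -- it times the mean length of its cycles, and it has to be `β b`.
  set z : ℝ := ∑ b, β b / ℓ b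
  have hz : 0 < z := Finset.sum_pos (fun b _ => div_pos (hβ b) (hpos b)) Finset.univ_nonempty
  have hq_pos (b : B) : 0 < β b / ℓ b / z := div_pos (div_pos (hβ b) (hpos b)) hz
  let q : PMF B := PMF.ofFintype (fun b => ENNReal.ofReal (β b / ℓ b / z)) (by
    rw [← ENNReal.ofReal_sum_of_nonneg fun b _ => (hq_pos b).le, ← Finset.sum_div,
      div_self hz.ne', ENNReal.ofReal_one])
  have hq (b : B) : q b = ENNReal.ofReal (β b / ℓ b / z) := rfl
  have hq_top (b : B) : q b < ∞ := ENNReal.ofReal_lt_top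
  have hcycle : (mix Φ q).cycleMean = ∑ b, q b * (Φ b).cycleMean := meanCost_mix_none Φ q _
  have hmatch (e : Sym2 V) : (mix Φ q).matchMean e = ∑ b, q b * (Φ b).matchMean e :=
    meanCost_mix_none Φ q _
  have hmix : (mix Φ q).cycleMean < ∞ := by
    rw [hcycle]
    exact ENNReal.sum_lt_top.2 fun b _ => ENNReal.mul_lt_top (hq_top b) (hfin b)
  have hirr' : (mix Φ q).IsIrreducible :=
    isIrreducible_mix (fun b => (ENNReal.ofReal_pos.2 (hq_pos b)).ne') hirr
  refine ⟨q, hirr', hirr'.isStable hmix, (hasMatchingRates_iff hmix).2 fun e => ?_⟩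
  have hreal (f : B → ℝ≥0∞) (hf : ∀ b, f b < ∞) :
      (∑ b, q b * f b).toReal = (∑ b, β b * ((f b).toReal / ℓ b)) / z := by
    rw [ENNReal.toReal_sum fun b _ => (ENNReal.mul_lt_top (hq_top b) (hf b)).ne,
      Finset.sum_div]
    refine Finset.sum_congr rfl fun b _ => ?_
    rw [ENNReal.toReal_mul, hq, ENNReal.toReal_ofReal (hq_pos b).le]
    ring
  rw [hcycle, hmatch, hreal _ hfin, hreal _ fun b => matchMean_lt_top (hfin b) e]
  have hone : ∑ b, β b * ((Φ b).cycleMean.toReal / ℓ b) = 1 := by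
    rw [← hsum]
    exact Finset.sum_congr rfl fun b _ => by rw [div_self (hpos b).ne', mul_one]
  rw [hone, div_div_div_cancel_right₀ hz.ne', div_one, Finset.mul_sum, Finset.sum_apply]
  refine Finset.sum_congr rfl fun b _ => ?_
  rw [Pi.smul_apply, smul_eq_mul, (hasMatchingRates_iff (hfin b)).1 (hμ b) e]
  ring

/-- The case of two policies, with the data in the form used by the sets of matching rates. -/
lemma exists_combination {S₁ S₂ : Type} [Countable S₁] [Countable S₂] [Infinite S₁]
    {Φ₁ : MatchingPolicy P.graph S₁} {Φ₂ : MatchingPolicy P.graph S₂}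
    (hirr₁ : Φ₁.IsIrreducible) (hirr₂ : Φ₂.IsIrreducible) (hst₁ : Φ₁.IsStable)
    (hst₂ : Φ₂.IsStable) {μ₁ μ₂ : P.graph.edgeSet → ℝ} (hμ₁ : Φ₁.HasMatchingRates μ₁)
    (hμ₂ : Φ₂.HasMatchingRates μ₂) {a b : ℝ} (ha : 0 < a) (hb : 0 < b) (hab : a + b = 1) :
    ∃ (S : Type) (_ : Countable S) (_ : Infinite S) (Φ : MatchingPolicy P.graph S),
      (Φ₁.IsGreedy → Φ₂.IsGreedy → Φ.IsGreedy) ∧ Φ.IsIrreducible ∧ Φ.IsStable ∧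
        Φ.HasMatchingRates (a • μ₁ + b • μ₂) := by
  let S : Bool → Type := fun i => bif i then S₁ else S₂
  let Φ : ∀ i, MatchingPolicy P.graph (S i)
    | true => Φ₁
    | false => Φ₂
  have hS : ∀ i, Countable (S i) := Bool.forall_bool.2 ⟨‹Countable S₂›, ‹Countable S₁›⟩
  obtain ⟨q, h1, h2, h3⟩ := exists_mix_hasMatchingRates (Φ := Φ)
    (μ := fun i => bif i then μ₁ else μ₂) (β := fun i => bif i then a else b)
    (Bool.forall_bool.2 ⟨hirr₂, hirr₁⟩) (Bool.forall_bool.2 ⟨hst₂, hst₁⟩)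
    (Bool.forall_bool.2 ⟨hμ₂, hμ₁⟩) (Bool.forall_bool.2 ⟨hb, ha⟩) (by simpa using hab)
  refine ⟨MixState Φ, inferInstance, ?_, mix Φ q,
    fun g₁ g₂ => isGreedy_mix Φ q (Bool.forall_bool.2 ⟨g₂, g₁⟩), h1, h2, by simpa using h3⟩
  have : Infinite (S true) := ‹Infinite S₁›
  exact Infinite.of_injective (mixEmbed Φ true) (mixEmbed_injective Φ true)

end MatchingPolicy

theorem mainTheorem8 {V : Type*} [Fintype V] [Nonempty V] [DecidableEq V]
    (P : MatchingProblem V) :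
    Convex ℝ P.greedyRates ∧ Convex ℝ P.policyRates := by
  constructor
  · refine convex_iff_forall_pos.2 ?_
    rintro μ₁ ⟨S₁, _, _, Φ₁, g₁, i₁, s₁, r₁⟩ μ₂ ⟨S₂, _, _, Φ₂, g₂, i₂, s₂, r₂⟩ a b ha hb hab
    obtain ⟨S, hc, hi, Φ, hg, h⟩ :=
      MatchingPolicy.exists_combination i₁ i₂ s₁ s₂ r₁ r₂ ha hb hab
    exact ⟨S, hc, hi, Φ, hg g₁ g₂, h⟩
  · refine convex_iff_forall_pos.2 ?_
    rintro μ₁ ⟨S₁, _, _, Φ₁, i₁, s₁, r₁⟩ μ₂ ⟨S₂, _, _, Φ₂, i₂, s₂, r₂⟩ a b ha hb hab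
    obtain ⟨S, hc, hi, Φ, -, h⟩ :=
      MatchingPolicy.exists_combination i₁ i₂ s₁ s₂ r₁ r₂ ha hb hab
    exact ⟨S, hc, hi, Φ, h⟩
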